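/- A \emph{rectangular tiling} is a partition of an axis-aligned rectangle into finitely many interior-disjoint (nondegenerate, closed, axis-aligned) rectangles $R_1,\dots,R_n$. Two of the rectangles are \emph{adjacent} if they touch, \emph{vertically} (\emph{horizontally}) \emph{adjacent} if they share a vertical (horizontal) segment of non-zero length, and \emph{corner adjacent} if they meet in a single point. The tiling is a \emph{rectangle contact representation} of the graph $G$ that has one vertex per rectangle and whose edges are the adjacent pairs. Two rectangles that share a segment of non-zero length are \emph{comparable} if the shared segment coincides with a side of one of them. The tiling is \emph{consistent} if every two rectangles that share a segment of non-zero length are comparable (corner adjacent pairs are not restricted). \textbf{Lemma.} For every rectangle contact representation $\mathcal R=(R_1,\dots,R_n)$ of a graph $G$ there is a consistent rectangle contact representation $\mathcal R_c=(R'_1,\dots,R'_n)$ of a supergraph of $G$ on the same vertices such that, for every comparable pair $R_i,R_j$ of $\mathcal R$: if $R_i,R_j$ are vertically adjacent then so are $R'_i,R'_j$, and if $R_i,R_j$ are horizontally adjacent then so are $R'_i,R'_j$. Moreover, $\mathcal R_c$ can be computed from the coordinates of $\mathcal R$ in a number of steps polynomial in $n$, by one program, for all $n$ and $\mathcal R$,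 on a random access machine whose only operations on the coordinates are addition, subtraction and comparison. -/

import Mathlib

open Set

noncomputable section

/-! ### Axis-aligned rectangles, adjacency and comparability -/

/-- A nondegenerate closed axis-aligned rectangle in the plane. -/
@[ext] structure Rect where
  left : ℝ
  right : ℝ
  bottom : ℝ
  top : ℝ
  left_lt_right : left < right
  bottom_lt_top : bottom < top

namespace Rect

/-- The closed point set `[left, right] × [bottom, top]`. -/
def region (R : Rect) : Set (ℝ × ℝ) := Icc R.left R.right ×ˢ Icc R.bottom R.top

/-- The four sides of a rectangle, as closed line segments. -/
def sides (R : Rect) : Set (Set (ℝ × ℝ)) :=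
  {{R.left} ×ˢ Icc R.bottom R.top, {R.right} ×ˢ Icc R.bottom R.top,
    Icc R.left R.right ×ˢ {R.bottom}, Icc R.left R.right ×ˢ {R.top}}

/-- The two rectangles do not overlap. -/
def InteriorDisjoint (R S : Rect) : Prop :=
  Disjoint (interior R.region) (interior S.region)

/-- The two rectangles touch but do not overlap (possibly only at a common corner). -/
def Adjacent (R S : Rect) : Prop :=
  R.InteriorDisjoint S ∧ (R.region ∩ S.region).Nonempty

/-- The two rectangles share a vertical segment of non-zero length. -/
def VerticallyAdjacent (R S : Rect) : Prop :=
  R.InteriorDisjoint S ∧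
    ∃ x a b : ℝ, a < b ∧ R.region ∩ S.region = {x} ×ˢ Icc a b

/-- The two rectangles share a horizontal segment of non-zero length. -/
def HorizontallyAdjacent (R S : Rect) : Prop :=
  R.InteriorDisjoint S ∧
    ∃ y a b : ℝ, a < b ∧ R.region ∩ S.region = Icc a b ×ˢ {y}

/-- The two rectangles share a segment of non-zero length (they are adjacent,
and not just corner adjacent). -/
def SegmentAdjacent (R S : Rect) : Prop :=
  R.VerticallyAdjacent S ∨ R.HorizontallyAdjacent S

/-- The rectangles share a segment, which coincides with a side of one of them. -/
def Comparable (R S : Rect) : Prop :=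
  R.SegmentAdjacent S ∧
    (R.region ∩ S.region ∈ R.sides ∨ R.region ∩ S.region ∈ S.sides)

end Rect

/-! ### Rectangular tilings and rectangle contact representations -/

/-- The rectangles `R i` form a partition of some rectangle into non-overlapping rectangles. -/
def IsRectangularTiling {n : ℕ} (R : Fin n → Rect) : Prop :=
  (∃ B : Rect, ⋃ i, (R i).region = B.region) ∧
    ∀ i j, i ≠ j → (R i).InteriorDisjoint (R j)

/-- The graph with one vertex per rectangle, joining the adjacent rectangles
(corner adjacency included). -/
def contactGraph {n : ℕ} (R : Fin n → Rect) : SimpleGraph (Fin n) where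
  Adj i j := i ≠ j ∧ (R i).Adjacent (R j)
  symm := ⟨fun _ _ h => ⟨h.1.symm, h.2.1.symm, by rw [inter_comm]; exact h.2.2⟩⟩
  loopless := ⟨fun _ h => h.1 rfl⟩

/-- `R` is a rectangle contact representation of the graph `G`. -/
def IsRectangleContactRepresentation {n : ℕ} (G : SimpleGraph (Fin n)) (R : Fin n → Rect) :
    Prop :=
  IsRectangularTiling R ∧ contactGraph R = G

/-- Every two rectangles of the family that share a segment are comparable. Rectangles that
meet in a single point have no shared segment, and are not constrained. -/
def IsConsistent {n : ℕ} (R : Fin n → Rect) : Prop :=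
  ∀ i j, i ≠ j → (R i).SegmentAdjacent (R j) → (R i).Comparable (R j)

/-! ### A random access machine over the reals, with a step count

There are two unbounded memories: an integer memory, whose cells hold natural numbers and which
is used for counters and for addresses, and a data memory, whose cells hold real numbers. The
only operations on data are addition, subtraction and comparison. In particular, on integer
data of at most `L` bits all numbers that occur within `T` steps have `O(L + T)` bits, so that
the step count is, up to a polynomial, also the running time on a Turing machine. -/

namespace RAM

/-- Contents of the integer memory and of the data memory. -/
structure State where
  idx : ℕ → ℕ
  dat : ℕ → ℝ

/-- Integer expressions; `mem a` is the content of the integer cell with address `a`. -/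
inductive IExp where
  | const (k : ℕ)
  | mem (a : IExp)
  | add (a b : IExp)
  | sub (a b : IExp)

/-- Data expressions; `mem a` is the content of the data cell with address `a`. -/
inductive DExp where
  | const (k : ℕ)
  | mem (a : IExp)
  | add (a b : DExp)
  | sub (a b : DExp)

/-- Tests. -/
inductive Test where
  | ilt (a b : IExp)
  | dlt (a b : DExp)
  | not (t : Test)
  | and (t u : Test)

/-- Programs. -/
inductive Cmd where
  | skip
  | iset (addr : IExp) (val : IExp)
  | dset (addr : IExp) (val : DExp)
  | seq (c d : Cmd)
  | branch (t : Test) (c d : Cmd)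
  | loop (t : Test) (c : Cmd)

/-- Value of an integer expression (subtraction is truncated). -/
def IExp.eval (s : State) : IExp → ℕ
  | const k => k
  | mem a => s.idx (a.eval s)
  | add a b => a.eval s + b.eval s
  | sub a b => a.eval s - b.eval s

/-- Value of a data expression. -/
def DExp.eval (s : State) : DExp → ℝ
  | const k => k
  | mem a => s.dat (a.eval s)
  | add a b => a.eval s + b.eval s
  | sub a b => a.eval s - b.eval s

/-- Truth of a test. -/
def Test.holds (s : State) : Test → Prop
  | ilt a b => a.eval s < b.eval s
  | dlt a b => a.eval s < b.eval s
  | not t => ¬ t.holds s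
  | and t u => t.holds s ∧ u.holds s

/-- Number of elementary operations in the evaluation of an integer expression. -/
def IExp.cost : IExp → ℕ
  | const _ => 1
  | mem a => a.cost + 1
  | add a b => a.cost + b.cost + 1
  | sub a b => a.cost + b.cost + 1

/-- Number of elementary operations in the evaluation of a data expression. -/
def DExp.cost : DExp → ℕ
  | const _ => 1
  | mem a => a.cost + 1
  | add a b => a.cost + b.cost + 1
  | sub a b => a.cost + b.cost + 1

/-- Number of elementary operations in the evaluation of a test. -/
def Test.cost : Test → ℕ
  | ilt a b => a.cost + b.cost + 1
  | dlt a b => a.cost + b.cost + 1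
  | not t => t.cost + 1
  | and t u => t.cost + u.cost + 1

/-- `Exec c s t s'`: the program `c`, started in state `s`, halts in state `s'` after exactly
`t` elementary steps. -/
inductive Exec : Cmd → State → ℕ → State → Prop where
  | skip (s : State) : Exec Cmd.skip s 1 s
  | iset (a e : IExp) (s : State) :
      Exec (Cmd.iset a e) s (a.cost + e.cost + 1)
        { s with idx := Function.update s.idx (a.eval s) (e.eval s) }
  | dset (a : IExp) (e : DExp) (s : State) :
      Exec (Cmd.dset a e) s (a.cost + e.cost + 1)
        { s with dat := Function.update s.dat (a.eval s) (e.eval s) }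
  | seq {c d : Cmd} {s s' s'' : State} {t t' : ℕ} :
      Exec c s t s' → Exec d s' t' s'' → Exec (Cmd.seq c d) s (t + t') s''
  | branch_true {b : Test} {c d : Cmd} {s s' : State} {t : ℕ} :
      b.holds s → Exec c s t s' → Exec (Cmd.branch b c d) s (b.cost + t) s'
  | branch_false {b : Test} {c d : Cmd} {s s' : State} {t : ℕ} :
      ¬ b.holds s → Exec d s t s' → Exec (Cmd.branch b c d) s (b.cost + t) s'
  | loop_false {b : Test} {c : Cmd} {s : State} :
      ¬ b.holds s → Exec (Cmd.loop b c) s b.cost s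
  | loop_true {b : Test} {c : Cmd} {s s' s'' : State} {t t' : ℕ} :
      b.holds s → Exec c s t s' → Exec (Cmd.loop b c) s' t' s'' →
      Exec (Cmd.loop b c) s (b.cost + t + t') s''

/-- The initial state for a family of `n` rectangles: the number `n` is in integer cell `0`, the
coordinates `left, right, bottom, top` of the rectangle `i` are in the data cells
`4 i, 4 i + 1, 4 i + 2, 4 i + 3`, and all other cells are zero. -/
def input {n : ℕ} (R : Fin n → Rect) : State where
  idx k := if k = 0 then n else 0
  dat k :=
    if h : k / 4 < n then
      if k % 4 = 0 then (R ⟨k / 4, h⟩).left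
      else if k % 4 = 1 then (R ⟨k / 4, h⟩).right
      else if k % 4 = 2 then (R ⟨k / 4, h⟩).bottom
      else (R ⟨k / 4, h⟩).top
    else 0

/-- The data memory of `s` holds, in its first `4 n` cells, the coordinates of the rectangles
`R i`, in the same layout as for the input. -/
def Outputs {n : ℕ} (s : State) (R : Fin n → Rect) : Prop :=
  ∀ i : Fin n, s.dat (4 * i) = (R i).left ∧ s.dat (4 * i + 1) = (R i).right ∧
    s.dat (4 * i + 2) = (R i).bottom ∧ s.dat (4 * i + 3) = (R i).top

end RAM

end

/-! By reflections, only one kind of incomparable pair has to be treated: `Bad p q`, where `p` is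
left of `q` along a line `x` and reaches higher. Let `y₀` be the bottom of `p` and `y₁ > y₀` the top
of `q`. Cut the tiling at height `y₀` left of `x`, along `x` from `y₀` to `y₁`, and at height `y₁`
right of `x`. Lift all that is above the cut by `y₁ - y₀`, stretching the rectangles that the cut
crosses. The bottom of `p` lands on the height of the top of `q`, and the pair keeps only a common
corner.

The lift is harmless because `p` and `q` fill the two sides of `x` near the cut, which leaves few
possible heights for the sides of rectangles reaching `x` (`Tiling.clear`). Hence the lift is
unambiguous on rectangles that cross `x`, and it preserves weak inequalities between sides of
rectangles whose horizontal extents meet (`shift_le_shift`). Strict inequalities survive if these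
extents overlap in more than a point (`shift_lt_shift`). Weak order gives the tiling, the contacts
and the comparabilities; its contrapositive shows that no bad pair on a vertical line is new, and
strict order shows the same for horizontal lines (`Tiling.refines_raise`).

As bad pairs never arise, one sweep over all ordered pairs removes a whole kind, and four sweeps,
conjugated by `mirror` and `transpose`, remove all kinds. A lift takes linear time, so the total is
cubic. -/

/-! ### Families of coordinate quadruples -/

/-- The four coordinates of an axis-aligned rectangle. -/
@[ext] structure Quad where
  l : ℝ
  r : ℝ
  b : ℝ
  t : ℝ

namespace Quad

/-- Reflection in the vertical axis. -/
def mirror (p : Quad) : Quad := ⟨-p.r, -p.l, p.b, p.t⟩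

/-- Reflection in the diagonal. -/
def transpose (p : Quad) : Quad := ⟨p.b, p.t, p.l, p.r⟩

@[simp] lemma mirror_mirror (p : Quad) : p.mirror.mirror = p := by simp [mirror]

@[simp] lemma transpose_transpose (p : Quad) : p.transpose.transpose = p := rfl

/-- Both sides have positive length. -/
def Nondeg (p : Quad) : Prop := p.l < p.r ∧ p.b < p.t

/-- The point `(x, y)` belongs to the closed rectangle. -/
def Mem (x y : ℝ) (p : Quad) : Prop := (p.l ≤ x ∧ x ≤ p.r) ∧ p.b ≤ y ∧ y ≤ p.t

/-- The closed rectangles intersect. -/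
def Touch (p q : Quad) : Prop := (p.l ≤ q.r ∧ q.l ≤ p.r) ∧ p.b ≤ q.t ∧ q.b ≤ p.t

/-- The open rectangles are disjoint. -/
def Apart (p q : Quad) : Prop := (p.r ≤ q.l ∨ q.r ≤ p.l) ∨ p.t ≤ q.b ∨ q.t ≤ p.b

/-- `q` is to the right of `p`, and one of the two facing sides contains the other. -/
def Facing (p q : Quad) : Prop :=
  p.r = q.l ∧ ((q.b ≤ p.b ∧ p.t ≤ q.t) ∨ (p.b ≤ q.b ∧ q.t ≤ p.t))

/-- `q` is to the right of `p`, and the facing sides overlap without containment,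
that of `p` being the higher one. -/
def Bad (p q : Quad) : Prop := p.r = q.l ∧ q.b < p.b ∧ p.b < q.t ∧ q.t < p.t

/-- Move up, by `y₁ - y₀`, those horizontal sides that are above the height `y₀` (inclusive) if the
rectangle lies to the left of `x`, and above the height `y₁` (exclusive) otherwise. -/
noncomputable def shift (x y₀ y₁ r c : ℝ) : ℝ :=
  if (r ≤ x ∧ y₀ ≤ c) ∨ y₁ < c then c + (y₁ - y₀) else c

/-- The effect of `shift` on a rectangle. -/
noncomputable def raise (x y₀ y₁ : ℝ) (p : Quad) : Quad :=
  ⟨p.l, p.r, shift x y₀ y₁ p.r p.b, shift x y₀ y₁ p.r p.t⟩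

end Quad

open Quad

variable {ι : Type*}

/-- The rectangles with coordinates `c i` tile a rectangle. -/
def Tiling (c : ι → Quad) : Prop :=
  (∀ i, (c i).Nondeg) ∧ (∀ i j, i ≠ j → (c i).Apart (c j)) ∧
    ∃ B : Quad, B.Nondeg ∧ ∀ x y, B.Mem x y ↔ ∃ i, (c i).Mem x y

/-- `c'` is a tiling that keeps the contacts and the comparabilities of `c`, and has no pairs of
incomparable rectangles in addition to those of `c`. -/
structure Refines (c c' : ι → Quad) : Prop where
  tiling : Tiling c'
  touch : ∀ i j, (c i).Touch (c j) → (c' i).Touch (c' j)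
  vert : ∀ i j, (c i).Facing (c j) → (c' i).Facing (c' j)
  horiz : ∀ i j, (c i).transpose.Facing (c j).transpose → (c' i).transpose.Facing (c' j).transpose
  bad : ∀ i j, (c' i).Bad (c' j) → (c i).Bad (c j)
  badM : ∀ i j, (c' i).mirror.Bad (c' j).mirror → (c i).mirror.Bad (c j).mirror
  badT : ∀ i j, (c' i).transpose.Bad (c' j).transpose → (c i).transpose.Bad (c j).transpose
  badTM : ∀ i j, (c' i).transpose.mirror.Bad (c' j).transpose.mirror →
    (c i).transpose.mirror.Bad (c j).transpose.mirror

lemma Refines.refl {c : ι → Quad} (h : Tiling c) : Refines c c :=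
  ⟨h, fun _ _ => id, fun _ _ => id, fun _ _ => id, fun _ _ => id, fun _ _ => id, fun _ _ => id,
    fun _ _ => id⟩

lemma Refines.trans {c d e : ι → Quad} (h : Refines c d) (k : Refines d e) : Refines c e :=
  ⟨k.tiling, fun i j => k.touch i j ∘ h.touch i j, fun i j => k.vert i j ∘ h.vert i j,
    fun i j => k.horiz i j ∘ h.horiz i j, fun i j => h.bad i j ∘ k.bad i j,
    fun i j => h.badM i j ∘ k.badM i j, fun i j => h.badT i j ∘ k.badT i j,
    fun i j => h.badTM i j ∘ k.badTM i j⟩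

/-! ### Symmetries -/

lemma Tiling.mirror {c : ι → Quad} (h : Tiling c) : Tiling fun i => (c i).mirror := by
  obtain ⟨h1, h2, B, hB, h3⟩ := h
  have mem : ∀ (p : Quad) (x y : ℝ), p.mirror.Mem x y ↔ p.Mem (-x) y := by
    intro p x y
    simp only [Quad.mirror, Mem]
    constructor <;> rintro ⟨⟨_, _⟩, _, _⟩ <;> refine ⟨⟨?_, ?_⟩, ?_, ?_⟩ <;> linarith
  refine ⟨fun i => ?_, fun i j hij => ?_, B.mirror, ?_, fun x y => ?_⟩
  · have := h1 i
    simpa [Nondeg, Quad.mirror] using this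
  · have := h2 i j hij
    simpa [Apart, Quad.mirror, or_comm] using this
  · simpa [Nondeg, Quad.mirror] using hB
  · simp only [mem, h3]

lemma Tiling.transpose {c : ι → Quad} (h : Tiling c) : Tiling fun i => (c i).transpose := by
  obtain ⟨h1, h2, B, hB, h3⟩ := h
  have mem : ∀ (p : Quad) (x y : ℝ), p.transpose.Mem x y ↔ p.Mem y x := by
    intro p x y
    simp only [Quad.transpose, Mem, and_comm]
  refine ⟨fun i => (h1 i).symm, fun i j hij => (h2 i j hij).symm, B.transpose, hB.symm,
    fun x y => ?_⟩
  simp only [mem, h3]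

lemma touch_mirror {p q : Quad} : p.mirror.Touch q.mirror ↔ p.Touch q := by
  simp [Touch, Quad.mirror, and_comm]

lemma facing_mirror {p q : Quad} : p.mirror.Facing q.mirror ↔ q.Facing p := by
  simp only [Facing, Quad.mirror, neg_inj]
  exact and_congr eq_comm or_comm

lemma facing_mirror_transpose {p q : Quad} :
    p.mirror.transpose.Facing q.mirror.transpose ↔ p.transpose.Facing q.transpose := by
  simp [Facing, Quad.mirror, Quad.transpose, and_comm]

/-- For a pair on a horizontal line, a left-right reflection changes which rectangle lies further to
the right. This exchanges the two kinds; since `Bad` lists the further one first, the arguments are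
swapped as well. -/
lemma bad_mirror_transpose {p q : Quad} : p.mirror.transpose.Bad q.mirror.transpose ↔
    q.transpose.mirror.Bad p.transpose.mirror := by
  simp only [Bad, Quad.mirror, Quad.transpose, neg_lt_neg_iff, neg_inj]
  grind

lemma bad_mirror_transpose_mirror {p q : Quad} :
    p.mirror.transpose.mirror.Bad q.mirror.transpose.mirror ↔ q.transpose.Bad p.transpose := by
  simp only [Bad, Quad.mirror, Quad.transpose, neg_lt_neg_iff, neg_inj]
  grind

lemma Refines.mirror {c d : ι → Quad} (h : Refines c d) :
    Refines (fun i => (c i).mirror) fun i => (d i).mirror where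
  tiling := h.tiling.mirror
  touch i j := by simpa only [touch_mirror] using h.touch i j
  vert i j := by simpa only [facing_mirror] using h.vert j i
  horiz i j := by simpa only [facing_mirror_transpose] using h.horiz i j
  bad i j := h.badM i j
  badM i j := by simpa only [mirror_mirror] using h.bad i j
  badT i j := by simpa only [bad_mirror_transpose] using h.badTM j i
  badTM i j := by simpa only [bad_mirror_transpose_mirror] using h.badT j i

lemma Refines.transpose {c d : ι → Quad} (h : Refines c d) :
    Refines (fun i => (c i).transpose) fun i => (d i).transpose where
  tiling := h.tiling.transpose
  touch i j k := (h.touch i j k.symm).symm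
  vert i j := h.horiz i j
  horiz i j := h.vert i j
  bad i j := h.badT i j
  badM i j := h.badTM i j
  badT i j := h.bad i j
  badTM i j := h.badM i j

/-! ### Alignment of one pair -/

/-- Every point of the box has a rectangle directly to its upper right. -/
lemma Tiling.exists_halfOpen [Finite ι] {c : ι → Quad} {B : Quad}
    (h : ∀ x y, B.Mem x y ↔ ∃ i, (c i).Mem x y) {x y : ℝ}
    (hx : B.l ≤ x ∧ x < B.r) (hy : B.b ≤ y ∧ y < B.t) :
    ∃ i, ((c i).l ≤ x ∧ x < (c i).r) ∧ (c i).b ≤ y ∧ y < (c i).t := by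
  by_contra! hne
  have small : ∀ u v : ℝ, u < v → ∀ᶠ ε in nhdsWithin (0 : ℝ) (Ioi 0), u + ε < v := by
    intro u v huv
    have : ∀ᶠ ε in nhds (0 : ℝ), ε < v - u := eventually_lt_nhds (by linarith)
    filter_upwards [nhdsWithin_le_nhds this] with ε hε
    linarith
  have pos : ∀ᶠ ε in nhdsWithin (0 : ℝ) (Ioi 0), 0 < ε := self_mem_nhdsWithin
  -- A rectangle that is not directly to the upper right misses the diagonal points near `(x, y)`.
  -- By finiteness one `ε` works for all, against the covering.
  have key : ∀ i, ∀ᶠ ε in nhdsWithin (0 : ℝ) (Ioi 0), ¬ (c i).Mem (x + ε) (y + ε) := by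
    intro i
    by_cases h1 : (c i).l ≤ x
    · by_cases h2 : x < (c i).r
      · by_cases h3 : (c i).b ≤ y
        · have h4 := hne i ⟨h1, h2⟩ h3
          filter_upwards [pos] with ε hε hm
          linarith [hm.2.2]
        · filter_upwards [small _ _ (not_le.1 h3)] with ε hε hm
          linarith [hm.2.1]
      · filter_upwards [pos] with ε hε hm
        linarith [hm.1.2]
    · filter_upwards [small _ _ (not_le.1 h1)] with ε hε hm
      linarith [hm.1.1]
  obtain ⟨ε, h0, h1, h2, h3⟩ := ((Filter.eventually_all.2 key).and
    (pos.and ((small _ _ hx.2).and (small _ _ hy.2)))).exists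
  obtain ⟨i, hi⟩ := (h (x + ε) (y + ε)).1
    ⟨⟨by linarith [hx.1], h2.le⟩, by linarith [hy.1], h3.le⟩
  exact h0 i hi

/-- A map that is monotone in the second argument stretches a column of a tiling to a column of a
tiling. -/
lemma Tiling.exists_of_monotone [Finite ι] {c : ι → Quad} {B : Quad}
    (hap : ∀ i j, i ≠ j → (c i).Apart (c j))
    (h : ∀ x y, B.Mem x y ↔ ∃ i, (c i).Mem x y) (hB : B.Nondeg) {x y : ℝ}
    (hx : B.l ≤ x ∧ x < B.r) (f : ℝ → ℝ) (h0 : f B.b ≤ y) (h1 : y ≤ f B.t) :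
    ∃ i, ((c i).l ≤ x ∧ x < (c i).r) ∧ f (c i).b ≤ y ∧ y ≤ f (c i).t := by
  classical
  have := Fintype.ofFinite ι
  let S : Finset ι := Finset.univ.filter fun i =>
    ((c i).l ≤ x ∧ x < (c i).r) ∧ (B.b ≤ (c i).b ∧ (c i).t ≤ B.t ∧ (c i).b < (c i).t) ∧
      f (c i).b ≤ y
  have inside : ∀ i z, ((c i).l ≤ x ∧ x < (c i).r) → (c i).b ≤ z → z < (c i).t →
      B.b ≤ (c i).b ∧ (c i).t ≤ B.t := by
    intro i z hi h2 h3
    exact ⟨((h x (c i).b).2 ⟨i, ⟨hi.1, hi.2.le⟩, le_rfl, by linarith⟩).2.1,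
      ((h x (c i).t).2 ⟨i, ⟨hi.1, hi.2.le⟩, by linarith, le_rfl⟩).2.2⟩
  have hS : S.Nonempty := by
    obtain ⟨i, hi, h2, h3⟩ := Tiling.exists_halfOpen h hx ⟨le_rfl, hB.2⟩
    have h4 := inside i _ hi h2 h3
    have h5 : (c i).b = B.b := le_antisymm h2 h4.1
    exact ⟨i, by simp only [S, Finset.mem_filter, Finset.mem_univ, true_and]
                 exact ⟨hi, ⟨h4.1, h4.2, by linarith⟩, h5 ▸ h0⟩⟩
  -- Take the topmost rectangle of the column whose image starts at or below `y`. If its image ended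
  -- below `y`, the next rectangle up, which starts where this one ends, would also qualify.
  obtain ⟨i, hi, hmax⟩ := S.exists_max_image (fun i => (c i).b) hS
  simp only [S, Finset.mem_filter, Finset.mem_univ, true_and] at hi hmax
  obtain ⟨hix, ⟨hib, hit, hibt⟩, hiy⟩ := hi
  refine ⟨i, hix, hiy, ?_⟩
  by_contra! hlt
  have htB : (c i).t < B.t := lt_of_le_of_ne hit fun he => by rw [he] at hlt; linarith
  obtain ⟨m, hmx, hm1, hm2⟩ := Tiling.exists_halfOpen h hx ⟨by linarith, htB⟩
  have him : i ≠ m := by rintro rfl; linarith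
  have hbm : (c m).b = (c i).t := by
    rcases hap i m him with (h5 | h5) | h5 | h5 <;> linarith
  have h4 := inside m _ hmx hm1 hm2
  have := hmax m ⟨hmx, ⟨h4.1, h4.2, by linarith⟩, by rw [hbm]; exact hlt.le⟩
  linarith

/-! ### Order of the shifted sides -/

/-- `y` is not strictly between the horizontal sides of an incomparable pair with common vertical
line `x`, insofar as the rectangle with horizontal extent `[l, r]` meets the pair. -/
structure Clear (x bq y₀ y₁ tp l r y : ℝ) : Prop where
  left : l < x → x ≤ r → y ≤ y₀ ∨ tp ≤ y
  right : l ≤ x → x < r → y ≤ bq ∨ y₁ ≤ y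

section shift

variable {x bq y₀ y₁ tp : ℝ}

/-- Both conditions of `Clear` apply and keep `y` out of the open interval from `bq` to `tp`, which
contains both thresholds. -/
lemma shift_eq_of_crossing (h1 : bq < y₀) (h2 : y₀ < y₁) (h3 : y₁ < tp) {l r y r' : ℝ}
    (h : Clear x bq y₀ y₁ tp l r y) (hl : l < x) (hr : x < r) :
    shift x y₀ y₁ r y = shift x y₀ y₁ r' y := by
  have := h.left hl hr.le
  have := h.right hl.le hr
  unfold shift
  grind

lemma shift_strictMono (h2 : y₀ < y₁) (r : ℝ) : StrictMono (shift x y₀ y₁ r) := by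
  intro u v huv
  unfold shift
  split_ifs <;> grind

/-- The critical case is that `u`, left of `x`, moves and `v` does not. Then `Clear` forces `u = y₀`
and `v = y₁`, and the images coincide. -/
lemma shift_le_shift (h1 : bq < y₀) (h2 : y₀ < y₁) (h3 : y₁ < tp) {l r u l' r' v : ℝ}
    (h : Clear x bq y₀ y₁ tp l r u) (h' : Clear x bq y₀ y₁ tp l' r' v)
    (hl : l < r) (hlr : l' ≤ r) (huv : u ≤ v) :
    shift x y₀ y₁ r u ≤ shift x y₀ y₁ r' v := by
  have e1 := h.left
  have e2 := h.right
  have e3 := h'.left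
  have e4 := h'.right
  unfold shift
  split_ifs <;> grind

/-- In the critical case `r ≤ x < r'`, the condition `l' < r` makes the second rectangle cross `x`.
If `u` moves, then `v > y₀`, so `v ≥ tp` and `v` moves too. -/
lemma shift_lt_shift (h2 : y₀ < y₁) (h3 : y₁ < tp) {l r u l' r' v : ℝ}
    (h : Clear x bq y₀ y₁ tp l r u) (h' : Clear x bq y₀ y₁ tp l' r' v)
    (hlr : l' < r) (huv : u < v) :
    shift x y₀ y₁ r u < shift x y₀ y₁ r' v := by
  have e1 := h.left
  have e2 := h.right
  have e3 := h'.left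
  have e4 := h'.right
  unfold shift
  split_ifs <;> grind

end shift

/-! ### Lifting a tiling along a bad pair -/

/-- A rectangle with points just left of the common line either is `c i` or avoids its interior
there, so it has no horizontal side strictly between those of `c i`. The same holds on the right
with `c j`. -/
lemma Tiling.clear {c : ι → Quad} (hc : Tiling c) {i j : ι} (hb : (c i).Bad (c j)) (k : ι) :
    Clear (c i).r (c j).b (c i).b (c j).t (c i).t (c k).l (c k).r (c k).b ∧
      Clear (c i).r (c j).b (c i).b (c j).t (c i).t (c k).l (c k).r (c k).t := by
  obtain ⟨hnd, hap, -⟩ := hc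
  obtain ⟨e, h1, h2, h3⟩ := hb
  have ki : k = i ∨ (c k).Apart (c i) := or_iff_not_imp_left.2 (hap k i)
  have kj : k = j ∨ (c k).Apart (c j) := or_iff_not_imp_left.2 (hap k j)
  have nk := hnd k
  have ni := hnd i
  have nj := hnd j
  unfold Apart at ki kj
  unfold Nondeg at nk ni nj
  constructor <;> constructor <;> intro hl hr
  · rcases ki with rfl | ki <;> grind
  · rcases kj with rfl | kj <;> grind
  · rcases ki with rfl | ki <;> grind
  · rcases kj with rfl | kj <;> grind

lemma Tiling.raise [Finite ι] {c : ι → Quad} (hc : Tiling c) {i j : ι} (hb : (c i).Bad (c j)) :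
    Tiling fun k => (c k).raise (c i).r (c i).b (c j).t := by
  have hcl := hc.clear hb
  obtain ⟨hnd, hap, B, hB, hcov⟩ := hc
  obtain ⟨e, h1, h2, h3⟩ := hb
  have hin : ∀ k, (B.l ≤ (c k).l ∧ (c k).r ≤ B.r) ∧ B.b ≤ (c k).b ∧ (c k).t ≤ B.t := by
    intro k
    have n := hnd k
    have u := (hcov (c k).l (c k).b).2 ⟨k, ⟨le_rfl, n.1.le⟩, le_rfl, n.2.le⟩
    have v := (hcov (c k).r (c k).t).2 ⟨k, ⟨n.1.le, le_rfl⟩, n.2.le, le_rfl⟩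
    exact ⟨⟨u.1.1, v.1.2⟩, u.2.1, v.2.2⟩
  -- The box starts below both thresholds, because of `c j`, and ends above both, because of `c i`;
  -- so its edges shift uniformly.
  have hBb : ∀ r, shift (c i).r (c i).b (c j).t r B.b = B.b := by
    intro r
    have := (hin j).2.1
    unfold shift
    grind
  have hBt : ∀ r, shift (c i).r (c i).b (c j).t r B.t = B.t + ((c j).t - (c i).b) := by
    intro r
    have := (hin i).2.2
    unfold shift
    grind
  refine ⟨fun k => ⟨(hnd k).1, shift_strictMono h2 _ (hnd k).2⟩, fun k m hkm => ?_,
    ⟨B.l, B.r, B.b, B.t + ((c j).t - (c i).b)⟩, ⟨hB.1, ?_⟩, fun x y => ⟨?_, ?_⟩⟩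
  · by_cases hx : (c k).r ≤ (c m).l ∨ (c m).r ≤ (c k).l
    · exact Or.inl hx
    · have hx' := not_or.1 hx
      have s1 := shift_le_shift h1 h2 h3 (hcl k).2 (hcl m).1 (hnd k).1
        (not_le.1 hx'.1).le
      have s2 := shift_le_shift h1 h2 h3 (hcl m).2 (hcl k).1 (hnd m).1
        (not_le.1 hx'.2).le
      exact Or.inr (((hap k m hkm).resolve_left hx).imp s1 s2)
  · have := hB.2
    show B.b < _
    dsimp only
    linarith
  · intro hm
    have closed : IsClosed {z : ℝ × ℝ | ∃ k,
        ((c k).raise (c i).r (c i).b (c j).t).Mem z.1 z.2} := by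
      simp only [ofPred_exists, Mem]
      refine isClosed_iUnion_of_finite fun k => ?_
      exact ((isClosed_le continuous_const continuous_fst).inter
        (isClosed_le continuous_fst continuous_const)).inter
        ((isClosed_le continuous_const continuous_snd).inter
        (isClosed_le continuous_snd continuous_const))
    have sub : Ico B.l B.r ×ˢ Icc B.b (B.t + ((c j).t - (c i).b)) ⊆ {z : ℝ × ℝ | ∃ k,
        ((c k).raise (c i).r (c i).b (c j).t).Mem z.1 z.2} := by
      rintro ⟨x, y⟩ ⟨hx, hy⟩
      have hx : B.l ≤ x ∧ x < B.r := hx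
      have hy : B.b ≤ y ∧ y ≤ B.t + ((c j).t - (c i).b) := hy
      by_cases hxi : x < (c i).r
      · obtain ⟨k, hk, k1, k2⟩ := Tiling.exists_of_monotone hap hcov hB hx
          (shift (c i).r (c i).b (c j).t (c i).r) (y := y) (by rw [hBb]; exact hy.1)
          (by rw [hBt]; exact hy.2)
        refine ⟨k, ⟨hk.1, hk.2.le⟩, ?_⟩
        have hsame : ∀ z, Clear (c i).r (c j).b (c i).b (c j).t (c i).t (c k).l (c k).r z →
            shift (c i).r (c i).b (c j).t (c k).r z =
              shift (c i).r (c i).b (c j).t (c i).r z := by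
          intro z hz
          by_cases hkr : (c i).r < (c k).r
          · exact shift_eq_of_crossing h1 h2 h3 hz (by linarith [hk.1]) hkr
          · simp only [shift, not_lt.1 hkr, le_refl]
        refine ⟨?_, ?_⟩
        · show shift _ _ _ _ _ ≤ _
          rw [hsame _ (hcl k).1]; exact k1
        · show _ ≤ shift _ _ _ _ _
          rw [hsame _ (hcl k).2]; exact k2
      -- Any number exceeding `(c i).r` selects the right-hand rule of `shift`; `(c i).r + 1` is
      -- one.
      · obtain ⟨k, hk, k1, k2⟩ := Tiling.exists_of_monotone hap hcov hB hx
          (shift (c i).r (c i).b (c j).t ((c i).r + 1)) (y := y) (by rw [hBb]; exact hy.1)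
          (by rw [hBt]; exact hy.2)
        refine ⟨k, ⟨hk.1, hk.2.le⟩, ?_⟩
        have n1 : ¬ (c k).r ≤ (c i).r := by have := hk.2; linarith
        have n2 : ¬ (c i).r + 1 ≤ (c i).r := by linarith
        have hsame : ∀ z, shift (c i).r (c i).b (c j).t (c k).r z =
              shift (c i).r (c i).b (c j).t ((c i).r + 1) z := by
          intro z
          simp only [shift, n1, n2]
        refine ⟨?_, ?_⟩
        · show shift _ _ _ _ _ ≤ _
          rw [hsame]; exact k1
        · show _ ≤ shift _ _ _ _ _
          rw [hsame]; exact k2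
    -- The half-open columns omit the right edge of the box; closedness of the finite union supplies
    -- it.
    have := closure_minimal sub closed
    rw [closure_prod_eq, closure_Ico hB.1.ne, closure_Icc] at this
    exact this (show (x, y) ∈ Icc B.l B.r ×ˢ Icc B.b (B.t + ((c j).t - (c i).b)) from hm)
  · rintro ⟨k, hk⟩
    obtain ⟨⟨k1, k2⟩, k3, k4⟩ := hin k
    have m1 := (shift_strictMono (x := (c i).r) h2 (c k).r).monotone k3
    have m2 := (shift_strictMono (x := (c i).r) h2 (c k).r).monotone k4
    rw [hBb] at m1
    rw [hBt] at m2
    exact ⟨⟨k1.trans hk.1.1, hk.1.2.trans k2⟩, m1.trans hk.2.1, hk.2.2.trans m2⟩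

lemma Tiling.refines_raise [Finite ι] {c : ι → Quad} (hc : Tiling c) {i j : ι}
    (hb : (c i).Bad (c j)) : Refines c fun k => (c k).raise (c i).r (c i).b (c j).t := by
  have hcl := hc.clear hb
  have hnd := hc.1
  have key := hb
  obtain ⟨e, h1, h2, h3⟩ := key
  have le : ∀ k m u v, (c m).l ≤ (c k).r → (u = (c k).b ∨ u = (c k).t) →
      (v = (c m).b ∨ v = (c m).t) → u ≤ v →
      shift (c i).r (c i).b (c j).t (c k).r u ≤ shift (c i).r (c i).b (c j).t (c m).r v := by
    intro k m u v q hu hv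
    refine shift_le_shift h1 h2 h3 ?_ ?_ (hnd k).1 q
    · rcases hu with rfl | rfl; exacts [(hcl k).1, (hcl k).2]
    · rcases hv with rfl | rfl; exacts [(hcl m).1, (hcl m).2]
  have lt : ∀ k m u v, (c m).l < (c k).r → (u = (c k).b ∨ u = (c k).t) →
      (v = (c m).b ∨ v = (c m).t) → u < v →
      shift (c i).r (c i).b (c j).t (c k).r u < shift (c i).r (c i).b (c j).t (c m).r v := by
    intro k m u v q hu hv
    refine shift_lt_shift (bq := (c j).b) (l := (c k).l) h2 h3 ?_ ?_ q
    · rcases hu with rfl | rfl; exacts [(hcl k).1, (hcl k).2]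
    · rcases hv with rfl | rfl; exacts [(hcl m).1, (hcl m).2]
  have of_lt : ∀ k m u v, (c k).l ≤ (c m).r → (c m).l ≤ (c k).r → (u = (c k).b ∨ u = (c k).t) →
      (v = (c m).b ∨ v = (c m).t) →
      shift (c i).r (c i).b (c j).t (c k).r u < shift (c i).r (c i).b (c j).t (c m).r v → u < v := by
    intro k m u v p q hu hv hlt
    by_contra! hle
    exact absurd (le m k v u p hv hu hle) (not_le.2 hlt)
  have inj : ∀ k m u v, (c k).l < (c m).r → (c m).l < (c k).r → (u = (c k).b ∨ u = (c k).t) →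
      (v = (c m).b ∨ v = (c m).t) →
      shift (c i).r (c i).b (c j).t (c k).r u = shift (c i).r (c i).b (c j).t (c m).r v → u = v := by
    intro k m u v p q hu hv he
    rcases lt_trichotomy u v with hlt | hlt | hlt
    · exact absurd he (lt k m u v q hu hv hlt).ne
    · exact hlt
    · exact absurd he (lt m k v u p hv hu hlt).ne'
  have hl : ∀ k, (c k).l < (c k).r := fun k => (hnd k).1
  refine ⟨hc.raise hb, ?_, ?_, ?_, ?_, ?_, ?_, ?_⟩ <;> intro k m
  · rintro ⟨⟨p, q⟩, u, v⟩
    exact ⟨⟨p, q⟩, le k m _ _ q (Or.inl rfl) (Or.inr rfl) u,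
      le m k _ _ p (Or.inl rfl) (Or.inr rfl) v⟩
  · rintro ⟨x, h⟩
    have p : (c k).l ≤ (c m).r := by linarith [hl k, hl m]
    have q : (c m).l ≤ (c k).r := x.ge
    exact ⟨x, h.imp
      (fun h => ⟨le m k _ _ p (Or.inl rfl) (Or.inl rfl) h.1,
        le k m _ _ q (Or.inr rfl) (Or.inr rfl) h.2⟩)
      (fun h => ⟨le k m _ _ q (Or.inl rfl) (Or.inl rfl) h.1,
        le m k _ _ p (Or.inr rfl) (Or.inr rfl) h.2⟩)⟩
  · rintro ⟨x, h⟩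
    have x : (c k).t = (c m).b := x
    have h : ((c m).l ≤ (c k).l ∧ (c k).r ≤ (c m).r) ∨ (c k).l ≤ (c m).l ∧ (c m).r ≤ (c k).r := h
    have p : (c k).l ≤ (c m).r := by rcases h with h | h <;> linarith [hl k, hl m]
    have q : (c m).l ≤ (c k).r := by rcases h with h | h <;> linarith [hl k, hl m]
    exact ⟨le_antisymm (le k m _ _ q (Or.inr rfl) (Or.inl rfl) x.le)
      (le m k _ _ p (Or.inl rfl) (Or.inr rfl) x.ge), h⟩
  · rintro ⟨x, u, v, w⟩
    have x : (c k).r = (c m).l := x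
    have p : (c k).l ≤ (c m).r := by linarith [hl k, hl m]
    have q : (c m).l ≤ (c k).r := x.ge
    exact ⟨x, of_lt m k _ _ q p (Or.inl rfl) (Or.inl rfl) u,
      of_lt k m _ _ p q (Or.inl rfl) (Or.inr rfl) v, of_lt m k _ _ q p (Or.inr rfl) (Or.inr rfl) w⟩
  · rintro ⟨x, u, v, w⟩
    have x' : (c k).l = (c m).r := neg_injective x
    have p : (c k).l ≤ (c m).r := x'.le
    have q : (c m).l ≤ (c k).r := by linarith [hl k, hl m]
    exact ⟨x, of_lt m k _ _ q p (Or.inl rfl) (Or.inl rfl) u,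
      of_lt k m _ _ p q (Or.inl rfl) (Or.inr rfl) v, of_lt m k _ _ q p (Or.inr rfl) (Or.inr rfl) w⟩
  -- For a pair on a horizontal line the extents overlap in a segment, so the shift is injective on
  -- the sides concerned and the contact was there before.
  · rintro ⟨x, h⟩
    have h' : (c m).l < (c k).l ∧ (c k).l < (c m).r ∧ (c m).r < (c k).r := h
    exact ⟨inj k m _ _ h'.2.1 (by linarith [hl k]) (Or.inr rfl) (Or.inl rfl) x, h⟩
  · rintro ⟨x, h⟩
    have x' := neg_injective x
    have h' : (c m).l < (c k).l ∧ (c k).l < (c m).r ∧ (c m).r < (c k).r := h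
    exact ⟨congrArg Neg.neg (inj k m _ _ h'.2.1 (by linarith [hl k]) (Or.inl rfl) (Or.inr rfl) x'), h⟩

/-- The bottom of `p` moves exactly to the top of `q`, which stays in place. -/
lemma not_bad_raise {p q : Quad} (hq : q.Nondeg) (hb : p.Bad q) :
    ¬ (p.raise p.r p.b q.t).Bad (q.raise p.r p.b q.t) := by
  rintro ⟨-, -, h, -⟩
  obtain ⟨e, -⟩ := hb
  have n : ¬ q.r ≤ p.r := by rw [e]; exact not_le.2 hq.1
  simp [Quad.raise, shift, n] at h

/-! ### Execution of programs -/

namespace RAM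

/-- `c` halts from `s` after at most `T` steps, in a state with the property `P`. -/
def Runs (c : Cmd) (s : State) (T : ℕ) (P : State → Prop) : Prop :=
  ∃ t s', Exec c s t s' ∧ t ≤ T ∧ P s'

lemma Runs.mono {c : Cmd} {s : State} {T T' : ℕ} {P P' : State → Prop} (h : Runs c s T P)
    (hT : T ≤ T') (hP : ∀ s, P s → P' s) : Runs c s T' P' := by
  obtain ⟨t, s', h1, h2, h3⟩ := h
  exact ⟨t, s', h1, h2.trans hT, hP _ h3⟩

lemma Runs.skip {s : State} {P : State → Prop} (h : P s) : Runs .skip s 1 P :=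
  ⟨_, _, .skip s, le_rfl, h⟩

lemma Runs.iset {a e : IExp} {s : State} {P : State → Prop}
    (h : P { s with idx := Function.update s.idx (a.eval s) (e.eval s) }) :
    Runs (.iset a e) s (a.cost + e.cost + 1) P :=
  ⟨_, _, .iset a e s, le_rfl, h⟩

lemma Runs.dset {a : IExp} {e : DExp} {s : State} {P : State → Prop}
    (h : P { s with dat := Function.update s.dat (a.eval s) (e.eval s) }) :
    Runs (.dset a e) s (a.cost + e.cost + 1) P :=
  ⟨_, _, .dset a e s, le_rfl, h⟩

lemma Runs.seq {c d : Cmd} {s : State} {T T' : ℕ} {P : State → Prop}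
    (h : Runs c s T fun s' => Runs d s' T' P) : Runs (.seq c d) s (T + T') P := by
  obtain ⟨t, s', h1, h2, t', s'', h3, h4, h5⟩ := h
  exact ⟨_, _, .seq h1 h3, by omega, h5⟩

lemma Runs.branch {b : Test} {c d : Cmd} {s : State} {T T' : ℕ} {P : State → Prop}
    (hc : b.holds s → Runs c s T P) (hd : ¬ b.holds s → Runs d s T' P) :
    Runs (.branch b c d) s (b.cost + (T + T')) P := by
  by_cases hb : b.holds s
  · obtain ⟨t, s', h1, h2, h3⟩ := hc hb
    exact ⟨_, _, .branch_true hb h1, by omega, h3⟩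
  · obtain ⟨t, s', h1, h2, h3⟩ := hd hb
    exact ⟨_, _, .branch_false hb h1, by omega, h3⟩

/-- The content of the integer cell `i`. -/
def cell (i : ℕ) : IExp := .mem (.const i)

/-- Run `c` for all values of the integer cell `i` below the value of the integer cell `0`. -/
def forLoop (i : ℕ) (c : Cmd) : Cmd :=
  .seq (.iset (.const i) (.const 0)) (.loop (.ilt (cell i) (cell 0))
    (.seq c (.iset (.const i) (.add (cell i) (.const 1)))))

/-- The integer cell `i` is set to `k`. -/
def State.setIdx (s : State) (i k : ℕ) : State := { s with idx := Function.update s.idx i k }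

/-- `I k` is the invariant when the counter is `k`; the body must leave the counter at `k`. Each
round costs 5 for the test and 6 for the increment; 8 is the initialization plus the last test. -/
lemma Runs.forLoop {i n T : ℕ} {c : Cmd} {s : State} (I : ℕ → State → Prop)
    (idx : ∀ k s, I k s → s.idx 0 = n) (init : I 0 (s.setIdx i 0))
    (step : ∀ k < n, ∀ s, s.idx i = k → I k s →
      Runs c s T fun s' => s'.idx i = k ∧ I (k + 1) (s'.setIdx i (k + 1))) :
    Runs (forLoop i c) s (8 + n * (T + 11)) (I n) := by
  have main : ∀ m k s, k + m = n → s.idx i = k → I k s →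
      Runs (.loop (.ilt (cell i) (cell 0))
        (.seq c (.iset (.const i) (.add (cell i) (.const 1))))) s (5 + m * (T + 11)) (I n) := by
    intro m
    induction m with
    | zero =>
      intro k s hk hs hI
      refine ⟨_, _, .loop_false ?_, ?_, by rwa [← hk]⟩
      · simp [Test.holds, cell, IExp.eval, hs, idx k s hI]
        omega
      · simp [Test.cost, cell, IExp.cost]
    | succ m ih =>
      intro k s hk hs hI
      obtain ⟨t, s', h1, h2, h3, h4⟩ := step k (by omega) s hs hI
      obtain ⟨t', s'', h5, h6, h7⟩ := ih (k + 1) (s'.setIdx i (k + 1)) (by omega)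
        (by simp [State.setIdx]) h4
      have h8 : Exec (.iset (.const i) (.add (cell i) (.const 1))) s' 6
          (s'.setIdx i (k + 1)) := by
        have := Exec.iset (.const i) (.add (cell i) (.const 1)) s'
        simpa [IExp.cost, IExp.eval, cell, h3, State.setIdx] using this
      refine ⟨_, _, .loop_true ?_ (.seq h1 h8) h5, ?_, h7⟩
      · simp [Test.holds, cell, IExp.eval, hs, idx k s hI]
        omega
      · simp only [Test.cost, cell, IExp.cost]
        rw [Nat.succ_mul]
        omega
  refine Runs.mono (Runs.seq (Runs.iset (main n 0 _ (by omega) ?_ ?_))) ?_ fun _ => id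
  · simp [IExp.eval]
  · simpa [IExp.eval, State.setIdx] using init
  · simp only [IExp.cost]
    omega

/-! ### Records of four data cells -/

/-- The data cells `4 k, …, 4 k + 3`. -/
def State.record (s : State) (k : ℕ) : Quad :=
  ⟨s.dat (4 * k), s.dat (4 * k + 1), s.dat (4 * k + 2), s.dat (4 * k + 3)⟩

@[simp] lemma State.record_setIdx (s : State) (i k j : ℕ) :
    (s.setIdx i k).record j = s.record j := rfl

lemma State.idx_setIdx (s : State) (i k j : ℕ) :
    (s.setIdx i k).idx j = if j = i then k else s.idx j := Function.update_apply ..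

/-- Address of the field `o` of the record whose number is in the integer cell `i`. -/
def adr (i o : ℕ) : IExp :=
  .add (.add (.add (cell i) (cell i)) (.add (cell i) (cell i))) (.const o)

/-- Content of the field `o` of the record whose number is in the integer cell `i`. -/
def field (i o : ℕ) : DExp := .mem (adr i o)

lemma eval_adr (s : State) (i o : ℕ) : (adr i o).eval s = 4 * s.idx i + o := by
  simp only [adr, cell, IExp.eval]
  ring

@[simp] lemma cost_adr (i o : ℕ) : (adr i o).cost = 13 := rfl

@[simp] lemma cost_field (i o : ℕ) : (field i o).cost = 14 := rfl

@[simp] lemma eval_field_zero (s : State) (i : ℕ) :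
    (field i 0).eval s = (s.record (s.idx i)).l := by
  simp [field, DExp.eval, eval_adr, State.record]

@[simp] lemma eval_field_one (s : State) (i : ℕ) :
    (field i 1).eval s = (s.record (s.idx i)).r := by
  simp [field, DExp.eval, eval_adr, State.record]

@[simp] lemma eval_field_two (s : State) (i : ℕ) :
    (field i 2).eval s = (s.record (s.idx i)).b := by
  simp [field, DExp.eval, eval_adr, State.record]

@[simp] lemma eval_field_three (s : State) (i : ℕ) :
    (field i 3).eval s = (s.record (s.idx i)).t := by
  simp [field, DExp.eval, eval_adr, State.record]

/-- `s'` differs from `s` at most in the record `k`, which is `p`. -/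
def Sets (s : State) (k : ℕ) (p : Quad) (s' : State) : Prop :=
  s'.idx = s.idx ∧ s'.record k = p ∧ ∀ j, j ≠ k → s'.record j = s.record j

lemma Sets.trans {s s' s'' : State} {k : ℕ} {p q : Quad} (h : Sets s k p s')
    (h' : Sets s' k q s'') : Sets s k q s'' :=
  ⟨h'.1.trans h.1, h'.2.1, fun j hj => (h'.2.2 j hj).trans (h.2.2 j hj)⟩

lemma Sets.refl (s : State) (k : ℕ) : Sets s k (s.record k) s := ⟨rfl, rfl, fun _ _ => rfl⟩

lemma runs_set_l {s : State} {i : ℕ} {e : DExp} : Runs (.dset (adr i 0) e) s (14 + e.cost)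
    (Sets s (s.idx i) { s.record (s.idx i) with l := e.eval s }) := by
  refine Runs.mono (Runs.dset ⟨rfl, ?_, fun j hj => ?_⟩) (by simp) fun _ => id
  · simp [State.record, eval_adr]
  · simp only [State.record, eval_adr]
    congr 1 <;> rw [Function.update_of_ne] <;> omega

lemma runs_set_r {s : State} {i : ℕ} {e : DExp} : Runs (.dset (adr i 1) e) s (14 + e.cost)
    (Sets s (s.idx i) { s.record (s.idx i) with r := e.eval s }) := by
  refine Runs.mono (Runs.dset ⟨rfl, ?_, fun j hj => ?_⟩) (by simp) fun _ => id
  · simp [State.record, eval_adr]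
  · simp only [State.record, eval_adr]
    congr 1 <;> rw [Function.update_of_ne] <;> omega

lemma runs_set_b {s : State} {i : ℕ} {e : DExp} : Runs (.dset (adr i 2) e) s (14 + e.cost)
    (Sets s (s.idx i) { s.record (s.idx i) with b := e.eval s }) := by
  refine Runs.mono (Runs.dset ⟨rfl, ?_, fun j hj => ?_⟩) (by simp) fun _ => id
  · simp [State.record, eval_adr]
  · simp only [State.record, eval_adr]
    congr 1 <;> rw [Function.update_of_ne] <;> omega

lemma runs_set_t {s : State} {i : ℕ} {e : DExp} : Runs (.dset (adr i 3) e) s (14 + e.cost)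
    (Sets s (s.idx i) { s.record (s.idx i) with t := e.eval s }) := by
  refine Runs.mono (Runs.dset ⟨rfl, ?_, fun j hj => ?_⟩) (by simp) fun _ => id
  · simp [State.record, eval_adr]
  · simp only [State.record, eval_adr]
    congr 1 <;> rw [Function.update_of_ne] <;> omega

/-- The first `n` records. -/
def State.family (n : ℕ) (s : State) : Fin n → Quad := fun i => s.record i

/-- A loop that applies `f` to each of the first `n` records; `f` may depend on the record `n`. -/
lemma runs_map {n T : ℕ} {c : Cmd} {s : State} (f : Quad → Quad) (hn : s.idx 0 = n)
    (hc : ∀ s' : State, s'.idx 0 = n → s'.record n = s.record n → s'.idx 3 < n →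
      Runs c s' T (Sets s' (s'.idx 3) (f (s'.record (s'.idx 3))))) :
    Runs (forLoop 3 c) s (8 + n * (T + 11)) fun s' =>
      (∀ i, i ≠ 3 → s'.idx i = s.idx i) ∧ s'.family n = fun i => f (s.family n i) := by
  refine Runs.mono (Runs.forLoop (fun k s' => (∀ i, i ≠ 3 → s'.idx i = s.idx i) ∧
    (∀ j, j < k → s'.record j = f (s.record j)) ∧ ∀ j, k ≤ j → s'.record j = s.record j)
    ?_ ?_ ?_) le_rfl ?_
  · intro k s' h
    rw [h.1 0 (by norm_num), hn]
  · refine ⟨fun i hi => ?_, by simp, by simp⟩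
    simp [State.idx_setIdx, hi]
  · rintro k hk s' hs ⟨h1, h2, h3⟩
    refine Runs.mono (hc s' ((h1 0 (by norm_num)).trans hn) (h3 n hk.le) (by omega)) le_rfl ?_
    rintro s'' ⟨g1, g2, g3⟩
    rw [hs] at g2 g3
    refine ⟨by rw [g1, hs], fun i hi => ?_, fun j hj => ?_, fun j hj => ?_⟩
    · simp [State.idx_setIdx, hi, g1, h1]
    · rw [State.record_setIdx]
      rcases eq_or_ne j k with rfl | hjk
      · rw [g2, h3 j le_rfl]
      · rw [g3 j hjk, h2 j (by omega)]
    · rw [State.record_setIdx, g3 j (by omega), h3 j (by omega)]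
  · rintro s' ⟨h1, h2, -⟩
    exact ⟨h1, funext fun i => h2 i i.2⟩

/-! ### The program -/

/-- Reflects all rectangles in the vertical axis. -/
def mirrorCmd : Cmd := forLoop 3 <|
  -- In place: `l` becomes `l - r`, then `r` becomes `-l`, then `l` becomes `(l - r) + (-l) = -r`.
  .seq (.dset (adr 3 0) (.sub (field 3 0) (field 3 1))) <|
  .seq (.dset (adr 3 1) (.sub (.const 0) (.add (field 3 0) (field 3 1)))) <|
    .dset (adr 3 0) (.add (field 3 0) (field 3 1))

lemma runs_mirrorCmd {n : ℕ} {s : State} (hn : s.idx 0 = n) :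
    Runs mirrorCmd s (8 + n * 200) fun s' =>
      s'.idx 0 = n ∧ s'.family n = fun i => (s.family n i).mirror := by
  refine Runs.mono (runs_map (T := 150) mirror hn ?_) (by gcongr; norm_num)
    fun s' h => ⟨(h.1 0 (by norm_num)).trans hn, h.2⟩
  intro s _ _ _
  refine Runs.mono (Runs.seq (runs_set_l.mono le_rfl fun s1 h1 =>
    Runs.seq (runs_set_r.mono le_rfl fun s2 h2 => runs_set_l.mono le_rfl fun s3 h3 => ?_)))
    (by simp [DExp.cost]) fun _ => id
  rw [h2.1, h1.1] at h3
  rw [h1.1] at h2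
  convert h1.trans (h2.trans h3) using 1
  simp [DExp.eval, h1.1, h2.1, h1.2.1, h2.2.1, mirror]
  ring

/-- Reflects all rectangles in the diagonal. -/
def transposeCmd : Cmd := forLoop 3 <|
  .seq (.dset (adr 3 0) (.sub (field 3 0) (field 3 2))) <|
  .seq (.dset (adr 3 2) (.add (field 3 2) (field 3 0))) <|
  .seq (.dset (adr 3 0) (.sub (field 3 2) (field 3 0))) <|
  .seq (.dset (adr 3 1) (.sub (field 3 1) (field 3 3))) <|
  .seq (.dset (adr 3 3) (.add (field 3 3) (field 3 1))) <|
    .dset (adr 3 1) (.sub (field 3 3) (field 3 1))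

lemma runs_transposeCmd {n : ℕ} {s : State} (hn : s.idx 0 = n) :
    Runs transposeCmd s (8 + n * 300) fun s' =>
      s'.idx 0 = n ∧ s'.family n = fun i => (s.family n i).transpose := by
  refine Runs.mono (runs_map (T := 270) transpose hn ?_) (by gcongr; norm_num)
    fun s' h => ⟨(h.1 0 (by norm_num)).trans hn, h.2⟩
  intro s _ _ _
  refine Runs.mono (Runs.seq (runs_set_l.mono le_rfl fun s1 h1 =>
    Runs.seq (runs_set_b.mono le_rfl fun s2 h2 =>
    Runs.seq (runs_set_l.mono le_rfl fun s3 h3 =>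
    Runs.seq (runs_set_r.mono le_rfl fun s4 h4 =>
    Runs.seq (runs_set_t.mono le_rfl fun s5 h5 => runs_set_r.mono le_rfl fun s6 h6 => ?_))))))
    (by simp [DExp.cost]) fun _ => id
  have i1 := h1.1
  have i2 := h2.1.trans i1
  have i3 := h3.1.trans i2
  have i4 := h4.1.trans i3
  have i5 := h5.1.trans i4
  rw [i1] at h2
  rw [i2] at h3
  rw [i3] at h4
  rw [i4] at h5
  rw [i5] at h6
  convert h1.trans (h2.trans (h3.trans (h4.trans (h5.trans h6)))) using 1
  simp [DExp.eval, i1, i2, i3, i4, i5, h1.2.1, h2.2.1, h3.2.1, h4.2.1, h5.2.1, transpose]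

/-- Whether the field `o` of the current record has to be shifted; the fields of the record that
follows the input hold the parameters of `Quad.shift`. -/
def shiftTest (o : ℕ) : Test :=
  .not (.and (.not (.and (.not (.dlt (field 0 0) (field 3 1)))
    (.not (.dlt (field 3 o) (field 0 1))))) (.not (.dlt (field 0 2) (field 3 o))))

/-- Shifts the field `o` of the current record. -/
def shiftCmd (o : ℕ) : Cmd :=
  .branch (shiftTest o)
    (.dset (adr 3 o) (.add (field 3 o) (.sub (field 0 2) (field 0 1)))) .skip

lemma runs_shiftCmd_two {s : State} : Runs (shiftCmd 2) s 200 (Sets s (s.idx 3)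
    { s.record (s.idx 3) with
      b :=
        shift (s.record (s.idx 0)).l (s.record (s.idx 0)).r (s.record (s.idx 0)).b
          (s.record (s.idx 3)).r (s.record (s.idx 3)).b }) := by
  refine Runs.mono (Runs.branch (fun h => runs_set_b.mono le_rfl fun s' h' => ?_)
    fun h => Runs.skip ?_) (by simp [shiftTest, Test.cost, DExp.cost]) fun _ => id
  · rw [shift, if_pos (by simpa [shiftTest, Test.holds, or_iff_not_imp_left] using h)]
    simpa [DExp.eval] using h'
  · rw [shift, if_neg (by simpa [shiftTest, Test.holds, or_iff_not_imp_left] using h)]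
    exact Sets.refl _ _

lemma runs_shiftCmd_three {s : State} : Runs (shiftCmd 3) s 200 (Sets s (s.idx 3)
    { s.record (s.idx 3) with
      t :=
        shift (s.record (s.idx 0)).l (s.record (s.idx 0)).r (s.record (s.idx 0)).b
          (s.record (s.idx 3)).r (s.record (s.idx 3)).t }) := by
  refine Runs.mono (Runs.branch (fun h => runs_set_t.mono le_rfl fun s' h' => ?_)
    fun h => Runs.skip ?_) (by simp [shiftTest, Test.cost, DExp.cost]) fun _ => id
  · rw [shift, if_pos (by simpa [shiftTest, Test.holds, or_iff_not_imp_left] using h)]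
    simpa [DExp.eval] using h'
  · rw [shift, if_neg (by simpa [shiftTest, Test.holds, or_iff_not_imp_left] using h)]
    exact Sets.refl _ _

/-- Applies `Quad.raise` to all rectangles. -/
def raiseCmd : Cmd := forLoop 3 (.seq (shiftCmd 2) (shiftCmd 3))

lemma runs_raiseCmd {n : ℕ} {s : State} (hn : s.idx 0 = n) :
    Runs raiseCmd s (8 + n * 411) fun s' => (∀ i, i ≠ 3 → s'.idx i = s.idx i) ∧
      s'.family n = fun i => (s.family n i).raise (s.record n).l (s.record n).r (s.record n).b := by
  refine runs_map (T := 400) _ hn fun s' h1 h2 h3 => ?_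
  refine Runs.seq (runs_shiftCmd_two.mono le_rfl fun s1 g1 =>
    runs_shiftCmd_three.mono le_rfl fun s2 g2 => ?_)
  have hne : n ≠ s'.idx 3 := by omega
  have e := g1.2.2 n hne
  rw [g1.1] at g2
  convert g1.trans g2 using 1
  simp only [raise, g1.2.1, h1, e, h2]

/-- Whether the records with numbers in the integer cells `1` and `2` form a bad pair. -/
def badTest : Test :=
  .and (.and (.not (.dlt (field 1 1) (field 2 0))) (.not (.dlt (field 2 0) (field 1 1))))
    (.and (.dlt (field 2 2) (field 1 2))
      (.and (.dlt (field 1 2) (field 2 3)) (.dlt (field 2 3) (field 1 3))))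

lemma holds_badTest {s : State} :
    badTest.holds s ↔ (s.record (s.idx 1)).Bad (s.record (s.idx 2)) := by
  simp only [badTest, Test.holds, eval_field_zero, eval_field_one, eval_field_two,
    eval_field_three, Bad]
  grind

/-- Aligns the records with numbers in the integer cells `1` and `2`, if they are a bad pair. -/
def alignCmd : Cmd :=
  .branch badTest
    -- Integer cell `0` contains `n`, so these writes go to the record `n`, beyond the family. The
    -- parameters are copied because the sides of the pair may change during the lift.
    (.seq (.dset (adr 0 0) (field 1 1)) <| .seq (.dset (adr 0 1) (field 1 2)) <|
      .seq (.dset (adr 0 2) (field 2 3)) raiseCmd) .skip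

lemma runs_alignCmd {n : ℕ} {s : State} (hn : s.idx 0 = n) {i j : Fin n} (hi : s.idx 1 = i)
    (hj : s.idx 2 = j) (ht : Tiling (s.family n)) :
    Runs alignCmd s (300 + n * 411) fun s' => (∀ i, i ≠ 3 → s'.idx i = s.idx i) ∧
      Refines (s.family n) (s'.family n) ∧ ¬ (s'.family n i).Bad (s'.family n j) := by
  have hij : badTest.holds s ↔ (s.family n i).Bad (s.family n j) := by
    rw [holds_badTest, hi, hj]; rfl
  refine Runs.mono (Runs.branch (fun h => Runs.seq (runs_set_l.mono le_rfl fun s1 h1 =>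
    Runs.seq (runs_set_r.mono le_rfl fun s2 h2 => Runs.seq (runs_set_b.mono le_rfl fun s3 h3 =>
    (runs_raiseCmd (n := n) ?_).mono le_rfl fun s4 h4 => ?_))))
    fun h => Runs.skip ⟨fun _ _ => rfl, .refl ht, hij.not.1 h⟩) ?_ fun _ => id
  · rw [h3.1, h2.1, h1.1, hn]
  · have i1 := h1.1
    have i2 := h2.1.trans i1
    have i3 := h3.1.trans i2
    rw [i1] at h2
    rw [i2] at h3
    rw [hn] at h1 h2 h3
    have hfam : s3.family n = s.family n := funext fun k =>
      (h1.trans (h2.trans h3)).2.2 k k.2.ne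
    have hrec : s3.record n = ⟨(s.family n i).r, (s.family n i).b, (s.family n j).t,
        (s.record n).t⟩ := by
      rw [h3.2.1, h2.2.1, h1.2.1]
      simp only [eval_field_one, eval_field_two, eval_field_three, i1, i2, hi, hj,
        h1.2.2 i i.2.ne, h2.2.2 j j.2.ne, h1.2.2 j j.2.ne]
      rfl
    have hb := hij.1 h
    refine ⟨fun k hk => by rw [h4.1 k hk, i3], ?_, ?_⟩
    · rw [h4.2, hfam, hrec]
      exact ht.refines_raise hb
    · rw [h4.2, hfam, hrec]
      exact not_bad_raise (ht.1 j) hb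
  · simp [badTest, Test.cost]
    omega

/-- Aligns all pairs of records. -/
def passCmd : Cmd := forLoop 1 (forLoop 2 alignCmd)

lemma runs_passCmd {n : ℕ} {s : State} (hn : s.idx 0 = n) (ht : Tiling (s.family n)) :
    Runs passCmd s (8 + n * (8 + n * (300 + n * 411 + 11) + 11)) fun s' => s'.idx 0 = n ∧
      Refines (s.family n) (s'.family n) ∧ ∀ i j, ¬ (s'.family n i).Bad (s'.family n j) := by
  refine Runs.mono (Runs.forLoop (fun a s' => s'.idx 0 = n ∧ Refines (s.family n) (s'.family n) ∧
    ∀ i j : Fin n, i < a → ¬ (s'.family n i).Bad (s'.family n j)) (fun _ _ h => h.1)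
    ⟨hn, .refl ht, by simp⟩ ?_) le_rfl fun s' h => ⟨h.1, h.2.1, fun i j => h.2.2 i j i.2⟩
  rintro a ha s1 hs1 ⟨h0, href, hbad⟩
  refine Runs.mono (Runs.forLoop (fun b s' => s'.idx 0 = n ∧ s'.idx 1 = a ∧
    Refines (s.family n) (s'.family n) ∧ ∀ i j : Fin n, (i : ℕ) < a ∨ (i : ℕ) = a ∧ j < b →
      ¬ (s'.family n i).Bad (s'.family n j)) (fun _ _ h => h.1)
    ⟨h0, hs1, href, fun i j h => hbad i j (by omega)⟩ ?_) le_rfl ?_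
  · rintro b hb s2 hs2 ⟨g0, g1, gref, gbad⟩
    refine (runs_alignCmd g0 (i := ⟨a, ha⟩) (j := ⟨b, hb⟩) g1 hs2 gref.tiling).mono le_rfl ?_
    rintro s3 ⟨k1, k2, k3⟩
    refine ⟨(k1 2 (by norm_num)).trans hs2, (k1 0 (by norm_num)).trans g0,
      (k1 1 (by norm_num)).trans g1, gref.trans k2, fun i j hij hB => ?_⟩
    -- Pairs treated earlier stay harmless, since a refinement has no new bad pairs.
    by_cases hlt : (i : ℕ) < a ∨ (i : ℕ) = a ∧ (j : ℕ) < b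
    · exact gbad i j hlt (k2.bad i j hB)
    · have e1 : i = ⟨a, ha⟩ := Fin.ext (by dsimp only; omega)
      have e2 : j = ⟨b, hb⟩ := Fin.ext (by dsimp only; omega)
      exact k3 (e1 ▸ e2 ▸ hB)
  · rintro s' ⟨k0, k1, kref, kbad⟩
    exact ⟨k1, k0, kref, fun i j hij => kbad i j (by omega)⟩

/-- Removes the incomparable pairs on vertical lines, then transposes. -/
def halfCmd : Cmd :=
  .seq passCmd <| .seq mirrorCmd <| .seq passCmd <| .seq mirrorCmd transposeCmd

lemma runs_halfCmd {n : ℕ} {s : State} (hn : s.idx 0 = n) (ht : Tiling (s.family n)) :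
    Runs halfCmd s (1000 + 1000 * n * (n + 1) * (n + 1)) fun s' => s'.idx 0 = n ∧ ∃ d,
      s'.family n = (fun i => (d i).transpose) ∧ Refines (s.family n) d ∧
      (∀ i j, ¬ (d i).Bad (d j)) ∧ ∀ i j, ¬ (d i).mirror.Bad (d j).mirror := by
  refine Runs.mono (Runs.seq ((runs_passCmd hn ht).mono le_rfl fun s1 ⟨a0, a1, a2⟩ =>
    Runs.seq ((runs_mirrorCmd a0).mono le_rfl fun s2 ⟨b0, b1⟩ =>
    Runs.seq ((runs_passCmd b0 ?_).mono le_rfl fun s3 ⟨c0, c1, c2⟩ =>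
    Runs.seq ((runs_mirrorCmd c0).mono le_rfl fun s4 ⟨d0, d1⟩ =>
    (runs_transposeCmd d0).mono le_rfl fun s5 ⟨e0, e1⟩ => ⟨e0, _, e1, ?_⟩)))))
    ?_ fun _ => id
  · rw [b1]
    exact a1.tiling.mirror
  · ring_nf
    omega
  · have := c1.mirror
    rw [b1] at this
    simp only [mirror_mirror] at this
    rw [d1]
    refine ⟨a1.trans this, fun i j h => a2 i j (this.bad i j h), fun i j h => c2 i j ?_⟩
    simpa using h

end RAM

/-! ### Rectangles and quadruples -/

namespace Rect

/-- The coordinates of a rectangle. -/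
def quad (R : Rect) : Quad := ⟨R.left, R.right, R.bottom, R.top⟩

lemma nondeg_quad (R : Rect) : R.quad.Nondeg := ⟨R.left_lt_right, R.bottom_lt_top⟩

lemma mem_region {R : Rect} {z : ℝ × ℝ} : z ∈ R.region ↔ R.quad.Mem z.1 z.2 := Iff.rfl

lemma interiorDisjoint_iff {R S : Rect} : R.InteriorDisjoint S ↔ R.quad.Apart S.quad := by
  have h1 := R.left_lt_right
  have h2 := S.left_lt_right
  have h3 := R.bottom_lt_top
  have h4 := S.bottom_lt_top
  simp only [InteriorDisjoint, region, interior_prod_eq, interior_Icc, disjoint_prod,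
    Ioo_disjoint_Ioo, Apart, quad, le_sup_iff, inf_le_iff]
  grind

lemma region_inter (R S : Rect) : R.region ∩ S.region =
    Icc (max R.left S.left) (min R.right S.right) ×ˢ
      Icc (max R.bottom S.bottom) (min R.top S.top) := by
  simp only [region, prod_inter_prod, Icc_inter_Icc]

lemma adjacent_iff {R S : Rect} :
    R.Adjacent S ↔ R.quad.Apart S.quad ∧ R.quad.Touch S.quad := by
  have h1 := R.left_lt_right
  have h2 := S.left_lt_right
  have h3 := R.bottom_lt_top
  have h4 := S.bottom_lt_top
  simp only [Adjacent, interiorDisjoint_iff, region_inter, prod_nonempty_iff, nonempty_Icc,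
    max_le_iff, le_min_iff, Touch, quad]
  grind

lemma Icc_prod_Icc_inj {a b c d a' b' c' d' : ℝ} (h : a ≤ b) (h' : c ≤ d) :
    Icc a b ×ˢ Icc c d = Icc a' b' ×ˢ Icc c' d' ↔ (a = a' ∧ b = b') ∧ c = c' ∧ d = d' := by
  rw [prod_eq_prod_iff_of_nonempty ((nonempty_Icc.2 h).prod (nonempty_Icc.2 h')),
    Icc_eq_Icc_iff h, Icc_eq_Icc_iff h']

lemma verticallyAdjacent_iff {R S : Rect} : R.VerticallyAdjacent S ↔
    (R.right = S.left ∨ S.right = R.left) ∧ max R.bottom S.bottom < min R.top S.top := by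
  have h1 := R.left_lt_right
  have h2 := S.left_lt_right
  simp only [VerticallyAdjacent, interiorDisjoint_iff, region_inter, ← Icc_self]
  constructor
  · rintro ⟨h, x, a, b, hab, e⟩
    rw [eq_comm, Icc_prod_Icc_inj le_rfl hab.le] at e
    obtain ⟨⟨e1, e2⟩, e3, e4⟩ := e
    simp only [Apart, quad] at h
    grind
  · rintro ⟨h, h'⟩
    refine ⟨Or.inl (h.imp Eq.le Eq.le), max R.left S.left, _, _, h', ?_⟩
    have : min R.right S.right = max R.left S.left := by grind
    rw [this]

lemma horizontallyAdjacent_iff {R S : Rect} : R.HorizontallyAdjacent S ↔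
    (R.top = S.bottom ∨ S.top = R.bottom) ∧ max R.left S.left < min R.right S.right := by
  have h1 := R.bottom_lt_top
  have h2 := S.bottom_lt_top
  simp only [HorizontallyAdjacent, interiorDisjoint_iff, region_inter, ← Icc_self]
  constructor
  · rintro ⟨h, x, a, b, hab, e⟩
    rw [eq_comm, Icc_prod_Icc_inj hab.le le_rfl] at e
    obtain ⟨⟨e1, e2⟩, e3, e4⟩ := e
    simp only [Apart, quad] at h
    grind
  · rintro ⟨h, h'⟩
    refine ⟨Or.inr (h.imp Eq.le Eq.le), max R.bottom S.bottom, _, _, h', ?_⟩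
    have : min R.top S.top = max R.bottom S.bottom := by grind
    rw [this]

lemma VerticallyAdjacent.symm {R S : Rect} (h : R.VerticallyAdjacent S) :
    S.VerticallyAdjacent R := by
  rw [verticallyAdjacent_iff] at h ⊢
  rwa [max_comm, min_comm, or_comm]

lemma HorizontallyAdjacent.symm {R S : Rect} (h : R.HorizontallyAdjacent S) :
    S.HorizontallyAdjacent R := by
  rw [horizontallyAdjacent_iff] at h ⊢
  rwa [max_comm, min_comm, or_comm]

/-- The intersection has zero width and positive height, so only a vertical side can equal it. -/
lemma VerticallyAdjacent.inter_mem_sides {R S : Rect} (h : R.VerticallyAdjacent S) :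
    R.region ∩ S.region ∈ R.sides ↔ S.bottom ≤ R.bottom ∧ R.top ≤ S.top := by
  obtain ⟨h, h'⟩ := verticallyAdjacent_iff.1 h
  have h1 := R.left_lt_right
  have h2 := S.left_lt_right
  have e : max R.left S.left = min R.right S.right := by grind
  simp only [region_inter, sides, mem_insert_iff, mem_singleton_iff]
  simp only [← Icc_self, Icc_prod_Icc_inj e.le h'.le]
  grind

lemma HorizontallyAdjacent.inter_mem_sides {R S : Rect} (h : R.HorizontallyAdjacent S) :
    R.region ∩ S.region ∈ R.sides ↔ S.left ≤ R.left ∧ R.right ≤ S.right := by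
  obtain ⟨h, h'⟩ := horizontallyAdjacent_iff.1 h
  have h1 := R.bottom_lt_top
  have h2 := S.bottom_lt_top
  have e : max R.bottom S.bottom = min R.top S.top := by grind
  simp only [region_inter, sides, mem_insert_iff, mem_singleton_iff]
  simp only [← Icc_self, Icc_prod_Icc_inj h'.le e.le]
  grind

lemma VerticallyAdjacent.comparable_iff {R S : Rect} (h : R.VerticallyAdjacent S) :
    R.Comparable S ↔ (S.bottom ≤ R.bottom ∧ R.top ≤ S.top) ∨
      (R.bottom ≤ S.bottom ∧ S.top ≤ R.top) := by
  rw [← h.inter_mem_sides, ← h.symm.inter_mem_sides, inter_comm S.region]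
  exact and_iff_right (Or.inl h)

lemma HorizontallyAdjacent.comparable_iff {R S : Rect} (h : R.HorizontallyAdjacent S) :
    R.Comparable S ↔ (S.left ≤ R.left ∧ R.right ≤ S.right) ∨
      (R.left ≤ S.left ∧ S.right ≤ R.right) := by
  rw [← h.inter_mem_sides, ← h.symm.inter_mem_sides, inter_comm S.region]
  exact and_iff_right (Or.inr h)

lemma VerticallyAdjacent.facing {R S : Rect} (h : R.VerticallyAdjacent S)
    (hc : R.Comparable S) : R.quad.Facing S.quad ∨ S.quad.Facing R.quad := by
  have hc := h.comparable_iff.1 hc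
  exact (verticallyAdjacent_iff.1 h).1.imp (fun e => ⟨e, hc⟩) fun e => ⟨e, hc.symm⟩

lemma HorizontallyAdjacent.facing {R S : Rect} (h : R.HorizontallyAdjacent S)
    (hc : R.Comparable S) : R.quad.transpose.Facing S.quad.transpose ∨
      S.quad.transpose.Facing R.quad.transpose := by
  have hc := h.comparable_iff.1 hc
  exact (horizontallyAdjacent_iff.1 h).1.imp (fun e => ⟨e, hc⟩) fun e => ⟨e, hc.symm⟩

lemma verticallyAdjacent_of_facing {R S : Rect} (h : R.quad.Facing S.quad) :
    R.VerticallyAdjacent S := by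
  have h1 := R.bottom_lt_top
  have h2 := S.bottom_lt_top
  obtain ⟨e, h⟩ := h
  simp only [quad] at e h
  exact verticallyAdjacent_iff.2 ⟨Or.inl e, by grind⟩

lemma horizontallyAdjacent_of_facing {R S : Rect}
    (h : R.quad.transpose.Facing S.quad.transpose) : R.HorizontallyAdjacent S := by
  have h1 := R.left_lt_right
  have h2 := S.left_lt_right
  obtain ⟨e, h⟩ := h
  simp only [quad, transpose] at e h
  exact horizontallyAdjacent_iff.2 ⟨Or.inl e, by grind⟩

/-- Overlapping facing sides without containment occur in four ways: either rectangle may be the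
left one, and either the higher one. -/
lemma VerticallyAdjacent.comparable {R S : Rect} (h : R.VerticallyAdjacent S)
    (h1 : ¬ R.quad.Bad S.quad) (h2 : ¬ S.quad.Bad R.quad)
    (h3 : ¬ R.quad.mirror.Bad S.quad.mirror) (h4 : ¬ S.quad.mirror.Bad R.quad.mirror) :
    R.Comparable S := by
  rw [h.comparable_iff]
  have := verticallyAdjacent_iff.1 h
  simp only [Bad, quad, mirror, neg_inj] at h1 h2 h3 h4
  grind

lemma HorizontallyAdjacent.comparable {R S : Rect} (h : R.HorizontallyAdjacent S)
    (h1 : ¬ R.quad.transpose.Bad S.quad.transpose) (h2 : ¬ S.quad.transpose.Bad R.quad.transpose)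
    (h3 : ¬ R.quad.transpose.mirror.Bad S.quad.transpose.mirror)
    (h4 : ¬ S.quad.transpose.mirror.Bad R.quad.transpose.mirror) : R.Comparable S := by
  rw [h.comparable_iff]
  have := horizontallyAdjacent_iff.1 h
  simp only [Bad, quad, mirror, transpose, neg_inj] at h1 h2 h3 h4
  grind

end Rect

lemma isRectangularTiling_iff {n : ℕ} {R : Fin n → Rect} :
    IsRectangularTiling R ↔ Tiling fun i => (R i).quad := by
  have cover : ∀ B : Rect, ⋃ i, (R i).region = B.region ↔
      ∀ x y, B.quad.Mem x y ↔ ∃ i, (R i).quad.Mem x y := by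
    intro B
    simp only [Set.ext_iff, mem_iUnion, Rect.mem_region, Prod.forall]
    exact forall₂_congr fun _ _ => Iff.comm
  simp only [IsRectangularTiling, Rect.interiorDisjoint_iff, cover]
  constructor
  · rintro ⟨⟨B, hB⟩, h⟩
    exact ⟨fun i => (R i).nondeg_quad, h, B.quad, B.nondeg_quad, hB⟩
  · rintro ⟨-, h, B, ⟨h1, h2⟩, hB⟩
    exact ⟨⟨⟨B.l, B.r, B.b, B.t, h1, h2⟩, hB⟩, h⟩

/-! ### Correctness of the whole program -/

namespace RAM

lemma family_input {n : ℕ} (R : Fin n → Rect) :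
    (input R).family n = fun i => (R i).quad := by
  funext i
  have h0 : 4 * (i : ℕ) / 4 = i := by omega
  have h1 : (4 * (i : ℕ) + 1) / 4 = i := by omega
  have h2 : (4 * (i : ℕ) + 2) / 4 = i := by omega
  have h3 : (4 * (i : ℕ) + 3) / 4 = i := by omega
  have m1 : (4 * (i : ℕ) + 1) % 4 = 1 := by omega
  have m2 : (4 * (i : ℕ) + 2) % 4 = 2 := by omega
  have m3 : (4 * (i : ℕ) + 3) % 4 = 3 := by omega
  simp [State.family, State.record, input, Rect.quad, h0, h1, h2, h3, m1, m2, m3]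

/-- The program makes a tiling consistent. -/
lemma runs_consistent {n : ℕ} {s : State} (hn : s.idx 0 = n) (ht : Tiling (s.family n)) :
    Runs (.seq halfCmd halfCmd) s (2000 + 2000 * n * (n + 1) * (n + 1)) fun s' =>
      Refines (s.family n) (s'.family n) ∧ ∀ i j,
        (¬ (s'.family n i).Bad (s'.family n j) ∧
          ¬ (s'.family n i).mirror.Bad (s'.family n j).mirror) ∧
        ¬ (s'.family n i).transpose.Bad (s'.family n j).transpose ∧
          ¬ (s'.family n i).transpose.mirror.Bad (s'.family n j).transpose.mirror := by
  refine Runs.mono (Runs.seq ((runs_halfCmd hn ht).mono le_rfl fun s1 h1 =>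
    (runs_halfCmd h1.1 ?_).mono le_rfl fun s2 h2 => ?_)) (by ring_nf; omega) fun _ => id
  · obtain ⟨-, d, e, h, -⟩ := h1
    rw [e]
    exact h.tiling.transpose
  · obtain ⟨-, d, e, h, hB, hM⟩ := h1
    obtain ⟨-, d', e', h', hB', hM'⟩ := h2
    rw [e] at h'
    -- The second half acts on the transposed tiling. Transposed back, it is a refinement, so the
    -- kinds removed by the first half do not return.
    have g := h'.transpose
    simp only [transpose_transpose] at g
    rw [e']
    refine ⟨h.trans g, fun i j => ⟨⟨fun k => hB i j (g.bad i j k), fun k => hM i j (g.badM i j k)⟩,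
      hB' i j, hM' i j⟩⟩

end RAM

theorem lemma1 :
    ∃ (prog : RAM.Cmd) (p : Polynomial ℕ),
      ∀ (n : ℕ) (G : SimpleGraph (Fin n)) (R : Fin n → Rect),
        IsRectangleContactRepresentation G R →
        ∃ (Gc : SimpleGraph (Fin n)) (Rc : Fin n → Rect),
          IsRectangleContactRepresentation Gc Rc ∧
          G ≤ Gc ∧
          IsConsistent Rc ∧
          (∀ i j, i ≠ j → (R i).Comparable (R j) →
            ((R i).VerticallyAdjacent (R j) → (Rc i).VerticallyAdjacent (Rc j)) ∧
            ((R i).HorizontallyAdjacent (R j) → (Rc i).HorizontallyAdjacent (Rc j))) ∧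
          ∃ (t : ℕ) (s : RAM.State),
            RAM.Exec prog (RAM.input R) t s ∧ t ≤ p.eval n ∧ RAM.Outputs s Rc := by
  refine ⟨.seq RAM.halfCmd RAM.halfCmd, 2000 + 2000 * .X * (.X + 1) * (.X + 1),
    fun n G R hR => ?_⟩
  obtain ⟨hR, rfl⟩ := hR
  have hfam := RAM.family_input R
  obtain ⟨t, s, hexec, htime, href, hbad⟩ := RAM.runs_consistent (s := RAM.input R) (n := n) rfl
    (hfam ▸ isRectangularTiling_iff.1 hR)
  rw [hfam] at href
  let Rc : Fin n → Rect := fun i => ⟨(s.family n i).l, (s.family n i).r, (s.family n i).b,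
    (s.family n i).t, (href.tiling.1 i).1, (href.tiling.1 i).2⟩
  have htil : IsRectangularTiling Rc := isRectangularTiling_iff.2 href.tiling
  refine ⟨contactGraph Rc, Rc, ⟨htil, rfl⟩, ?_, ?_, ?_, t, s, hexec, by simpa using htime,
    fun i => ⟨rfl, rfl, rfl, rfl⟩⟩
  · intro i j h
    exact ⟨h.1, Rect.adjacent_iff.2 ⟨href.tiling.2.1 i j h.1,
      href.touch i j (Rect.adjacent_iff.1 h.2).2⟩⟩
  · rintro i j - (h | h)
    · exact h.comparable (hbad i j).1.1 (hbad j i).1.1 (hbad i j).1.2 (hbad j i).1.2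
    · exact h.comparable (hbad i j).2.1 (hbad j i).2.1 (hbad i j).2.2 (hbad j i).2.2
  · intro i j _ hc
    refine ⟨fun h => ?_, fun h => ?_⟩
    · rcases h.facing hc with k | k
      · exact Rect.verticallyAdjacent_of_facing (href.vert i j k)
      · exact (Rect.verticallyAdjacent_of_facing (R := Rc j) (S := Rc i) (href.vert j i k)).symm
    · rcases h.facing hc with k | k
      · exact Rect.horizontallyAdjacent_of_facing (href.horiz i j k)
      · exact (Rect.horizontallyAdjacent_of_facing (R := Rc j) (S := Rc i) (href.horiz j i k)).symm
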